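/- Let $\iota_X\colon A\to X$ be any continuous map of topological spaces. The Ganea construction of $\iota_X$ is the sequence of maps $g_n\colon G_n\to X$ ($n\ge 0$) with $g_0=\iota_X\colon A\to X$ and $g_{n+1}$ the join of $g_n$ and $\iota_X$ over $X$: if $F_n$ is the homotopy pullback of $g_n$ and $\iota_X$, then $G_{n+1}$ is the homotopy pushout of the two projections $G_n\leftarrow F_n\to A$, and $g_{n+1}\colon G_{n+1}\to X$ is the whisker map induced by $g_n$, $\iota_X$ and the canonical homotopy on $F_n$. Let $\gamma_n\colon G_n\to G_{n+1}$ be the canonical map to the homotopy pushout and, for $k\le n$, let $\gamma_{k,n}=\gamma_{n-1}\circ\dots\circ\gamma_k\colon G_k\to G_n$, with $\gamma_{k,k}=\mathrm{id}_{G_k}$. A homotopy section of $g_n$ is a map $\sigma\colon X\to G_n$ with $g_n\circ\sigma\simeq\mathrm{id}_X$. The sectional category $\operatorname{secat}\iota_X$ is the least integer $n\ge 0$ such that $g_n$ has a homotopy section, and for $k\ge 0$ the relative category of order $k$, $\operatorname{relcat}_k\iota_X$, is the least integer $n\ge k$ such that $g_n$ has a homotopy section $\sigma$ with $\sigma\circ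 g_k\simeq\gamma_{k,n}$ (each is $\infty$ if there is no such $n$). Then for any map $\iota_X$ and any integer $k\ge 0$, $$\operatorname{secat}\iota_X\;\le\;\operatorname{relcat}_k\iota_X\;\le\;\operatorname{secat}\iota_X+k+1 .$$ -/

import Mathlib

universe u

open scoped unitInterval

namespace Ganea

/-- The (standard) homotopy pullback of `f : B → X` and `g : A → X`: triples `(b, ω, a)` where `ω`
is a path in `X` from `f b` to `g a`, with the topology induced from `B × X^I × A`. -/
def HPullback {B A X : Type u} [TopologicalSpace B] [TopologicalSpace A] [TopologicalSpace X]
    (f : C(B, X)) (g : C(A, X)) : Type u :=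
  {w : B × C(I, X) × A // w.2.1 0 = f w.1 ∧ w.2.1 1 = g w.2.2}

namespace HPullback

variable {B A X : Type u} [TopologicalSpace B] [TopologicalSpace A] [TopologicalSpace X]
  (f : C(B, X)) (g : C(A, X))

instance : TopologicalSpace (HPullback f g) :=
  inferInstanceAs (TopologicalSpace {w : B × C(I, X) × A // w.2.1 0 = f w.1 ∧ w.2.1 1 = g w.2.2})

/-- The projection of the homotopy pullback to `B`. -/
def fst : C(HPullback f g, B) :=
  ⟨fun w => w.1.1, continuous_fst.comp continuous_subtype_val⟩

/-- The projection of the homotopy pullback to `A`. -/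
def snd : C(HPullback f g, A) :=
  ⟨fun w => w.1.2.2, continuous_snd.comp (continuous_snd.comp continuous_subtype_val)⟩

/-- The path component `ω` of a point `(b, ω, a)` of the homotopy pullback. -/
def path : C(HPullback f g, C(I, X)) :=
  ⟨fun w => w.1.2.1, continuous_fst.comp (continuous_snd.comp continuous_subtype_val)⟩

theorem path_zero (w : HPullback f g) : path f g w 0 = f (fst f g w) := w.2.1

theorem path_one (w : HPullback f g) : path f g w 1 = g (snd f g w) := w.2.2

end HPullback

/-- The identifications `(w, 0) ∼ p w` and `(w, 1) ∼ q w` that define the double mapping cylinder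
of `p : F → B` and `q : F → A`. -/
inductive HPushout.Rel {F B A : Type u} [TopologicalSpace F] [TopologicalSpace B]
    [TopologicalSpace A] (p : C(F, B)) (q : C(F, A)) :
    B ⊕ (F × I) ⊕ A → B ⊕ (F × I) ⊕ A → Prop
  | zero (w : F) : HPushout.Rel p q (Sum.inr (Sum.inl (w, 0))) (Sum.inl (p w))
  | one (w : F) : HPushout.Rel p q (Sum.inr (Sum.inl (w, 1))) (Sum.inr (Sum.inr (q w)))

/-- The (standard) homotopy pushout of `p : F → B` and `q : F → A`, that is, their double mapping
cylinder with the quotient topology. -/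
def HPushout {F B A : Type u} [TopologicalSpace F] [TopologicalSpace B] [TopologicalSpace A]
    (p : C(F, B)) (q : C(F, A)) : Type u :=
  Quot (HPushout.Rel p q)

namespace HPushout

variable {F B A : Type u} [TopologicalSpace F] [TopologicalSpace B] [TopologicalSpace A]
  (p : C(F, B)) (q : C(F, A))

instance : TopologicalSpace (HPushout p q) :=
  inferInstanceAs (TopologicalSpace (Quot (HPushout.Rel p q)))

/-- The canonical map from `B` to the homotopy pushout. -/
def inl : C(B, HPushout p q) :=
  ⟨fun b => Quot.mk _ (Sum.inl b), continuous_quot_mk.comp continuous_inl⟩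

/-- The canonical map from `A` to the homotopy pushout. -/
def inr : C(A, HPushout p q) :=
  ⟨fun a => Quot.mk _ (Sum.inr (Sum.inr a)),
    continuous_quot_mk.comp (continuous_inr.comp continuous_inr)⟩

/-- The canonical map from the cylinder `F × I` to the homotopy pushout. -/
def cyl : C(F × I, HPushout p q) :=
  ⟨fun z => Quot.mk _ (Sum.inr (Sum.inl z)),
    continuous_quot_mk.comp (continuous_inr.comp continuous_inl)⟩

theorem cyl_zero (w : F) : cyl p q (w, 0) = inl p q (p w) := Quot.sound (Rel.zero w)

theorem cyl_one (w : F) : cyl p q (w, 1) = inr p q (q w) := Quot.sound (Rel.one w)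

/-- The whisker map out of the homotopy pushout that is given by maps `b` and `a` on the two ends
and a homotopy `c` from `b ∘ p` to `a ∘ q`. -/
def whisker {Y : Type u} [TopologicalSpace Y] (b : C(B, Y)) (a : C(A, Y)) (c : C(F × I, Y))
    (h0 : ∀ w, c (w, 0) = b (p w)) (h1 : ∀ w, c (w, 1) = a (q w)) : C(HPushout p q, Y) :=
  ⟨Quot.lift (Sum.elim b (Sum.elim c a)) (by
      rintro _ _ (w | w)
      · exact h0 w
      · exact h1 w),
    continuous_quot_lift _
      (b.continuous.sumElim (c.continuous.sumElim a.continuous))⟩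

end HPushout

/-- The total space of the join over `X` of `f : B → X` and `g : A → X`: the homotopy pushout of the
two projections of the homotopy pullback of `f` and `g`. -/
abbrev Join {B A X : Type u} [TopologicalSpace B] [TopologicalSpace A] [TopologicalSpace X]
    (f : C(B, X)) (g : C(A, X)) : Type u :=
  HPushout (HPullback.fst f g) (HPullback.snd f g)

/-- The join over `X` of `f : B → X` and `g : A → X`: the whisker map `(f, g)` to `X` of the
homotopy pushout, induced by the canonical homotopy `((b, ω, a), t) ↦ ω t` of the homotopy
pullback. -/
def joinMap {B A X : Type u} [TopologicalSpace B] [TopologicalSpace A] [TopologicalSpace X]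
    (f : C(B, X)) (g : C(A, X)) : C(Join f g, X) :=
  HPushout.whisker _ _ f g
    ⟨fun z => HPullback.path f g z.1 z.2, by fun_prop⟩
    (fun w => HPullback.path_zero f g w) (fun w => HPullback.path_one f g w)

/-- A topological space together with a continuous map to `X`. -/
structure SpaceOver (X : Type u) [TopologicalSpace X] where
  /-- the total space -/
  carrier : Type u
  /-- its topology -/
  [top : TopologicalSpace carrier]
  /-- the map to `X` -/
  map : C(carrier, X)

attribute [instance] SpaceOver.top

variable {A X : Type u} [TopologicalSpace A] [TopologicalSpace X]

/-- The Ganea construction of `ι : A → X`: it starts with `ι` itself, and the next stage is the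
join over `X` of the previous stage and `ι`. -/
def stage (ι : C(A, X)) : ℕ → SpaceOver X
  | 0 => ⟨A, ι⟩
  | n + 1 => ⟨Join (stage ι n).map ι, joinMap (stage ι n).map ι⟩

/-- The `n`-th Ganea space `G_n(ι)`. -/
abbrev G (ι : C(A, X)) (n : ℕ) : Type u := (stage ι n).carrier

/-- The `n`-th Ganea map `g_n(ι) : G_n(ι) → X`. -/
def g (ι : C(A, X)) (n : ℕ) : C(G ι n, X) := (stage ι n).map

/-- The map `γ_n : G_n(ι) → G_{n+1}(ι)` of the Ganea construction. -/
def gammaSucc (ι : C(A, X)) (n : ℕ) : C(G ι n, G ι (n + 1)) :=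
  HPushout.inl (HPullback.fst (stage ι n).map ι) (HPullback.snd (stage ι n).map ι)

/-- The map `γ_{k,n} = γ_{n-1} ∘ ⋯ ∘ γ_k : G_k(ι) → G_n(ι)` for `k ≤ n`; it is the identity if
`n = k`. -/
def gamma (ι : C(A, X)) {k n : ℕ} (h : k ≤ n) : C(G ι k, G ι n) :=
  Nat.leRec (motive := fun m _ => C(G ι k, G ι m)) (ContinuousMap.id _)
    (fun m _ γ => (gammaSucc ι m).comp γ) h

theorem gamma_self (ι : C(A, X)) (k : ℕ) : gamma ι (le_refl k) = ContinuousMap.id _ := by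
  simp [gamma]

theorem gamma_succ (ι : C(A, X)) {k n : ℕ} (h : k ≤ n) :
    gamma ι (Nat.le_succ_of_le h) = (gammaSucc ι n).comp (gamma ι h) := by
  simp only [gamma]
  rw [Nat.leRec_succ]

/-- `s` is a homotopy section of `f`. -/
def IsHomotopySection {E Y : Type u} [TopologicalSpace E] [TopologicalSpace Y]
    (f : C(E, Y)) (s : C(Y, E)) : Prop :=
  (f.comp s).Homotopic (ContinuousMap.id Y)

/-- The sectional category of `ι`: the least `n` such that `g_n` has a homotopy section
(`⊤` if there is no such `n`). -/
noncomputable def secat (ι : C(A, X)) : ℕ∞ :=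
  sInf {N : ℕ∞ | ∃ n : ℕ, N = n ∧ ∃ s : C(X, G ι n), IsHomotopySection (g ι n) s}

/-- The relative category of order `k` of `ι`: the least `n ≥ k` such that `g_n` has a homotopy
section `s` with `s ∘ g_k ≃ γ_{k,n}` (`⊤` if there is no such `n`). -/
noncomputable def relcat (k : ℕ) (ι : C(A, X)) : ℕ∞ :=
  sInf {N : ℕ∞ | ∃ n : ℕ, N = n ∧ ∃ h : k ≤ n, ∃ s : C(X, G ι n),
    IsHomotopySection (g ι n) s ∧ (s.comp (g ι k)).Homotopic (gamma ι h)}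

end Ganea

/-! The first inequality forgets a condition. For the second, each `g_n` is replaced by its path
fibration, so that a homotopy section becomes a strict section `ρ` and homotopies can be required to
be fibrewise over `X`. Two facts about joining once more with `A` carry the induction on `k`. In the
join, every map over `X` from `A` becomes fibrewise homotopic to the inclusion of `A`
(`fibHomotopic_inrHat`). Hence one extra stage makes `ρ ∘ g_0` and `γ_{0,n}` agree. A map over `X`
from a join `B * A`, pushed one stage further, is fibrewise homotopic to the join with `A` of its
restriction to `B` (`fibHomotopic_joinHat`), and joins preserve fibrewise homotopy
(`FibHomotopic.joinHat`). Hence agreement on `G_k` gives agreement on `G_{k+1}` one stage later. In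
all, `k + 1` stages are added. -/

namespace Ganea

namespace HPullback

/-- The map to the homotopy pullback that is given by its three components. -/
def lift {Z B A X : Type u} [TopologicalSpace Z] [TopologicalSpace B] [TopologicalSpace A]
    [TopologicalSpace X] {f : C(B, X)} {g : C(A, X)} (b : C(Z, B)) (p : C(Z × I, X)) (a : C(Z, A))
    (h0 : ∀ z, p (z, 0) = f (b z)) (h1 : ∀ z, p (z, 1) = g (a z)) : C(Z, HPullback f g) :=
  ⟨fun z => ⟨(b z, p.curry z, a z), h0 z, h1 z⟩,
    Continuous.subtype_mk (by fun_prop) _⟩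

theorem ext {B A X : Type u} [TopologicalSpace B] [TopologicalSpace A]
    [TopologicalSpace X] {f : C(B, X)} {g : C(A, X)} {w w' : HPullback f g}
    (hb : fst f g w = fst f g w') (hp : ∀ t, path f g w t = path f g w' t)
    (ha : snd f g w = snd f g w') : w = w' :=
  Subtype.ext (Prod.ext hb (Prod.ext (ContinuousMap.ext hp) ha))

end HPullback

namespace HPushout

variable {F B A : Type u} [TopologicalSpace F] [TopologicalSpace B] [TopologicalSpace A]
  {p : C(F, B)} {q : C(F, A)}

theorem induction {motive : HPushout p q → Prop} (hl : ∀ b, motive (inl p q b))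
    (hr : ∀ a, motive (inr p q a)) (hc : ∀ w t, motive (cyl p q (w, t))) (z : HPushout p q) :
    motive z := by
  induction z using Quot.ind with
  | mk z =>
    rcases z with b | ⟨w, t⟩ | a
    · exact hl b
    · exact hc w t
    · exact hr a

end HPushout

/-! ### Path fibrations and fibrewise homotopy -/

section PathSpace

variable {B E A X Z : Type u} [TopologicalSpace B] [TopologicalSpace E] [TopologicalSpace A]
  [TopologicalSpace X] [TopologicalSpace Z]

/-- The total space of the path fibration that replaces `e`: pairs of a point of `E` and a path in
`X` that starts at its image. -/
abbrev PathSpace (e : C(E, X)) : Type u := HPullback e (ContinuousMap.id X)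

/-- The path fibration that replaces `e`: it sends a path to its end point. -/
abbrev PathSpace.proj (e : C(E, X)) : C(PathSpace e, X) := HPullback.snd e (ContinuousMap.id X)

/-- The section of `PathSpace e → E` over a map to `E` given by constant paths. -/
def PathSpace.const (e : C(E, X)) : C(E, PathSpace e) :=
  HPullback.lift (ContinuousMap.id E) (e.comp ContinuousMap.fst) e (fun _ => rfl) (fun _ => rfl)

/-- Fibrewise homotopy of maps to the path fibration that replaces `e`. -/
abbrev FibHomotopic (e : C(E, X)) (p : C(Z, X)) (φ ψ : C(Z, PathSpace e)) : Prop :=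
  ContinuousMap.HomotopicWith φ ψ (fun χ => ∀ z, PathSpace.proj e (χ z) = p z)

/-- In curried form a homotopy out of a homotopy pushout is a whisker map into `C(I, _)`, so it is
never necessary to describe the pushout times `I` as a quotient. -/
theorem FibHomotopic.of_curried {e : C(E, X)} {p : C(Z, X)} {φ ψ : C(Z, PathSpace e)}
    (H : C(Z, C(I, PathSpace e))) (h0 : ∀ z, H z 0 = φ z) (h1 : ∀ z, H z 1 = ψ z)
    (hp : ∀ z s, PathSpace.proj e (H z s) = p z) : FibHomotopic e p φ ψ :=
  ⟨{ toContinuousMap := H.uncurry.comp ContinuousMap.prodSwap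
     map_zero_left := h0
     map_one_left := h1
     prop' := fun s z => hp z s }⟩

theorem FibHomotopic.exists_curried {e : C(E, X)} {p : C(Z, X)} {φ ψ : C(Z, PathSpace e)}
    (h : FibHomotopic e p φ ψ) : ∃ H : C(Z, C(I, PathSpace e)), (∀ z, H z 0 = φ z) ∧
      (∀ z, H z 1 = ψ z) ∧ ∀ z s, PathSpace.proj e (H z s) = p z := by
  obtain ⟨H⟩ := h
  exact ⟨(H.toContinuousMap.comp ContinuousMap.prodSwap).curry, fun z => H.apply_zero z,
    fun z => H.apply_one z, fun z s => H.prop s z⟩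

theorem FibHomotopic.homotopic_fst {e : C(E, X)} {p : C(Z, X)} {φ ψ : C(Z, PathSpace e)}
    (h : FibHomotopic e p φ ψ) :
    ((HPullback.fst e _).comp φ).Homotopic ((HPullback.fst e _).comp ψ) := by
  obtain ⟨H⟩ := h
  exact (ContinuousMap.Homotopic.refl (HPullback.fst e _)).comp ⟨H.toHomotopy⟩

/-! ### Path fibrations and the join with `A` -/

/-- The reparametrization `τ ↦ min (2τ) 1`. -/
noncomputable def firstHalf : C(I, I) :=
  ⟨fun τ => Set.projIcc 0 1 zero_le_one (2 * (τ : ℝ)), by fun_prop⟩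

/-- The reparametrization `τ ↦ max (2τ - 1) 0`. -/
noncomputable def secondHalf : C(I, I) :=
  ⟨fun τ => Set.projIcc 0 1 zero_le_one (2 * (τ : ℝ) - 1), by fun_prop⟩

/-- The reparametrization `(t, τ) ↦ t + τ (1 - t) / 2`. -/
noncomputable def sweep : C(I × I, I) :=
  ⟨fun z => ⟨(z.1 : ℝ) + z.2 * (1 - z.1) / 2, by
      obtain ⟨⟨t, ht0, ht1⟩, ⟨τ, h0, h1⟩⟩ := z
      constructor <;> dsimp only <;> nlinarith⟩, by fun_prop⟩

/-- The concatenation of the path of a point of `PathSpace e` with a path in `X` that starts at its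
end point. -/
noncomputable def concat (e : C(E, X)) (ι : C(A, X)) : C(HPullback (PathSpace.proj e) ι × I, X) where
  toFun z := if (z.2 : ℝ) ≤ 1 / 2
    then HPullback.path e _ (HPullback.fst _ ι z.1) (firstHalf z.2)
    else HPullback.path _ ι z.1 (secondHalf z.2)
  continuous_toFun := by
    refine Continuous.if_le (by fun_prop) (by fun_prop) (by fun_prop) (by fun_prop) ?_
    rintro ⟨d, t⟩ (h : (t : ℝ) = 1 / 2)
    have h1 : firstHalf t = 1 := by simp [firstHalf, h]
    have h2 : secondHalf t = 0 := by simp [secondHalf, h]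
    dsimp only
    rw [h1, h2, HPullback.path_one, HPullback.path_zero]
    rfl

theorem concat_sweep_zero (e : C(E, X)) (ι : C(A, X)) (d : HPullback (PathSpace.proj e) ι)
    (τ : I) : concat e ι (d, sweep (0, τ)) = HPullback.path e _ (HPullback.fst _ ι d) τ := by
  have h : ((sweep (0, τ) : I) : ℝ) = τ / 2 := by simp [sweep]
  have h1 : firstHalf (sweep (0, τ)) = τ := by
    simp only [firstHalf, ContinuousMap.coe_mk, h]
    rw [mul_div_cancel₀ _ two_ne_zero, Set.projIcc_val]
  have h2 : ((sweep (0, τ) : I) : ℝ) ≤ 1 / 2 := by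
    rw [h]; linarith [τ.2.2]
  simp only [concat, ContinuousMap.coe_mk, if_pos h2, h1]

theorem concat_sweep_one (e : C(E, X)) (ι : C(A, X)) (d : HPullback (PathSpace.proj e) ι)
    (t : I) : concat e ι (d, sweep (t, 1)) = HPullback.path _ ι d t := by
  have h : ((sweep (t, 1) : I) : ℝ) = (1 + t) / 2 := by simp [sweep]; ring
  have h1 : secondHalf (sweep (t, 1)) = t := by
    simp only [secondHalf, ContinuousMap.coe_mk, h]
    rw [mul_div_cancel₀ _ two_ne_zero, add_sub_cancel_left, Set.projIcc_val]
  by_cases ht : t = 0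
  · subst ht
    rw [concat_sweep_zero, HPullback.path_one, HPullback.path_zero]
    rfl
  · have h2 : ¬ ((sweep (t, 1) : I) : ℝ) ≤ 1 / 2 := by
      rw [h]; linarith [show (0 : ℝ) < t from unitInterval.pos_iff_ne_zero.2 ht]
    simp only [concat, ContinuousMap.coe_mk, if_neg h2, h1]

theorem sweep_zero_right (t : I) : sweep (t, 0) = t := by
  ext; simp [sweep]

theorem sweep_one_left (τ : I) : sweep (1, τ) = 1 := by
  ext; simp [sweep]

theorem concat_zero (e : C(E, X)) (ι : C(A, X)) (d : HPullback (PathSpace.proj e) ι) :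
    concat e ι (d, 0) = e (HPullback.fst e _ (HPullback.fst _ ι d)) := by
  rw [← sweep_zero_right 0, concat_sweep_zero, HPullback.path_zero]

theorem concat_one (e : C(E, X)) (ι : C(A, X)) (d : HPullback (PathSpace.proj e) ι) :
    concat e ι (d, 1) = ι (HPullback.snd _ ι d) := by
  rw [← sweep_one_left 1, concat_sweep_one, HPullback.path_one]

/-- The homotopy pullback of the path fibration that replaces `e` maps to that of `e`. -/
noncomputable def pullbackConcat (e : C(E, X)) (ι : C(A, X)) :
    C(HPullback (PathSpace.proj e) ι, HPullback e ι) :=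
  HPullback.lift ((HPullback.fst e _).comp (HPullback.fst _ ι)) (concat e ι) (HPullback.snd _ ι)
    (concat_zero e ι) (concat_one e ι)

/-- The map from the cylinder over the homotopy pullback of `PathSpace e` and `A` to the path
fibration that replaces the join. -/
noncomputable def cylHat (e : C(E, X)) (ι : C(A, X)) :
    C(HPullback (PathSpace.proj e) ι × I, PathSpace (joinMap e ι)) :=
  HPullback.lift
    ((HPushout.cyl _ _).comp ((pullbackConcat e ι).prodMap (ContinuousMap.id I)))
    -- The cylinder point at height `t` lies over time `t` of the concatenation, while the new path
    -- must end at time `t` of its second piece, that is, at time `(1 + t) / 2`; `sweep` joins these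
    -- times.
    ⟨fun z => concat e ι (z.1.1, sweep (z.1.2, z.2)), by fun_prop⟩
    ⟨fun z => HPullback.path _ ι z.1 z.2, by fun_prop⟩
    (fun z => by
      simp only [ContinuousMap.coe_mk, sweep_zero_right]
      rfl)
    (fun z => concat_sweep_one e ι z.1 z.2)

/-- The map of path fibrations induced by the inclusion of `E` in the join. -/
def inlHat (e : C(E, X)) (ι : C(A, X)) : C(PathSpace e, PathSpace (joinMap e ι)) :=
  HPullback.lift ((HPushout.inl _ _).comp (HPullback.fst e _))
    ⟨fun z => HPullback.path e _ z.1 z.2, by fun_prop⟩ (PathSpace.proj e)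
    (HPullback.path_zero e _) (HPullback.path_one e _)

/-- The inclusion of `A` in the join, with constant paths. -/
def inrHat (e : C(E, X)) (ι : C(A, X)) : C(A, PathSpace (joinMap e ι)) :=
  (PathSpace.const _).comp (HPushout.inr _ _)

theorem cylHat_zero (e : C(E, X)) (ι : C(A, X)) (d : HPullback (PathSpace.proj e) ι) :
    cylHat e ι (d, 0) = inlHat e ι (HPullback.fst _ ι d) :=
  HPullback.ext (HPushout.cyl_zero _ _ _) (concat_sweep_zero e ι d)
    (HPullback.path_zero _ ι d)

theorem cylHat_one (e : C(E, X)) (ι : C(A, X)) (d : HPullback (PathSpace.proj e) ι) :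
    cylHat e ι (d, 1) = inrHat e ι (HPullback.snd _ ι d) :=
  HPullback.ext (HPushout.cyl_one _ _ _)
    (fun τ => by
      change concat e ι (d, sweep (1, τ)) = ι _
      rw [sweep_one_left, concat_one])
    (HPullback.path_one _ ι d)

/-- A map over `X` to `PathSpace e` induces a map of homotopy pullbacks with `ι`. -/
def pullbackMap {e : C(E, X)} (ι : C(A, X)) {f : C(B, X)} (j : C(B, PathSpace e))
    (hj : ∀ b, PathSpace.proj e (j b) = f b) :
    C(HPullback f ι, HPullback (PathSpace.proj e) ι) :=
  HPullback.lift (j.comp (HPullback.fst f ι)) ⟨fun z => HPullback.path f ι z.1 z.2, by fun_prop⟩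
    (HPullback.snd f ι) (fun w => (HPullback.path_zero f ι w).trans (hj _).symm)
    (HPullback.path_one f ι)

/-- The join with `A` of a map over `X` to `PathSpace e`. -/
noncomputable def joinHat {e : C(E, X)} (ι : C(A, X)) {f : C(B, X)} (j : C(B, PathSpace e))
    (hj : ∀ b, PathSpace.proj e (j b) = f b) : C(Join f ι, PathSpace (joinMap e ι)) :=
  HPushout.whisker _ _ ((inlHat e ι).comp j) (inrHat e ι)
    ((cylHat e ι).comp ((pullbackMap ι j hj).prodMap (ContinuousMap.id I)))
    (fun _ => cylHat_zero e ι _) (fun _ => cylHat_one e ι _)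

/-! ### Fibrewise homotopies of maps into a join -/

/-- A map over `X` from `A` to `PathSpace e` becomes fibrewise homotopic to the canonical inclusion
of `A` in the join. -/
theorem fibHomotopic_inrHat {e : C(E, X)} {ι : C(A, X)} (φ : C(A, PathSpace e))
    (hφ : ∀ a, PathSpace.proj e (φ a) = ι a) :
    FibHomotopic (joinMap e ι) ι ((inlHat e ι).comp φ) (inrHat e ι) := by
  -- Joining `φ a` to `a` by a constant path gives a cylinder line from `φ a` to `a` that stays over
  -- `ι a`.
  let d : C(A, HPullback (PathSpace.proj e) ι) :=
    HPullback.lift φ (ι.comp ContinuousMap.fst) (ContinuousMap.id A)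
      (fun a => (hφ a).symm) (fun _ => rfl)
  exact FibHomotopic.of_curried
    ((cylHat e ι).comp (d.prodMap (ContinuousMap.id I))).curry
    (fun a => cylHat_zero e ι (d a)) (fun a => cylHat_one e ι (d a)) (fun _ _ => rfl)

/-- Fibrewise homotopic maps have fibrewise homotopic joins with `A`. -/
theorem FibHomotopic.joinHat {e : C(E, X)} {ι : C(A, X)} {f : C(B, X)} {j j' : C(B, PathSpace e)}
    (h : FibHomotopic e f j j') (hj : ∀ b, PathSpace.proj e (j b) = f b)
    (hj' : ∀ b, PathSpace.proj e (j' b) = f b) :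
    FibHomotopic (joinMap e ι) (joinMap f ι) (joinHat ι j hj) (joinHat ι j' hj') := by
  obtain ⟨H, H0, H1, Hp⟩ := h.exists_curried
  let d : C(HPullback f ι × I, HPullback (PathSpace.proj e) ι) :=
    HPullback.lift (H.uncurry.comp ((HPullback.fst f ι).prodMap (ContinuousMap.id I)))
      ⟨fun z => HPullback.path f ι z.1.1 z.2, by fun_prop⟩
      ((HPullback.snd f ι).comp ContinuousMap.fst)
      -- Fibrewise homotopy is essential here: the path to `A` is kept fixed while its starting
      -- point in `PathSpace e` moves.
      (fun z => (HPullback.path_zero f ι z.1).trans (Hp _ _).symm)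
      (fun z => HPullback.path_one f ι z.1)
  let c : C((HPullback f ι × I) × I, PathSpace (joinMap e ι)) :=
    (cylHat e ι).comp ⟨fun z => (d (z.1.1, z.2), z.1.2), by fun_prop⟩
  let K : C(Join f ι, C(I, PathSpace (joinMap e ι))) :=
    HPushout.whisker _ _ ((inlHat e ι).comp H.uncurry).curry
      ((inrHat e ι).comp ContinuousMap.fst).curry c.curry
      (fun w => ContinuousMap.ext fun s => cylHat_zero e ι (d (w, s)))
      (fun w => ContinuousMap.ext fun s => cylHat_one e ι (d (w, s)))
  refine FibHomotopic.of_curried K ?_ ?_ ?_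
  · refine HPushout.induction (fun b => ?_) (fun a => rfl) (fun w t => ?_)
    · exact congrArg (inlHat e ι) (H0 b)
    · refine congrArg (fun v => cylHat e ι (v, t)) (?_ : d (w, 0) = pullbackMap ι j hj w)
      exact HPullback.ext (H0 _) (fun _ => rfl) rfl
  · refine HPushout.induction (fun b => ?_) (fun a => rfl) (fun w t => ?_)
    · exact congrArg (inlHat e ι) (H1 b)
    · refine congrArg (fun v => cylHat e ι (v, t)) (?_ : d (w, 1) = pullbackMap ι j' hj' w)
      exact HPullback.ext (H1 _) (fun _ => rfl) rfl
  · exact HPushout.induction (fun b s => Hp b s) (fun a s => rfl) (fun w t s => rfl)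

/-- The first coordinate of the homotopy along the edges of a square: `(t, s) ↦ t min (1, 2 - 2s)`. -/
noncomputable def edgeFst : C(I × I, I) :=
  ⟨fun z => z.1 * firstHalf (unitInterval.symm z.2), by fun_prop⟩

/-- The second coordinate of the homotopy along the edges of a square: `(t, s) ↦ t min (1, 2s)`. -/
noncomputable def edgeSnd : C(I × I, I) :=
  ⟨fun z => z.1 * firstHalf z.2, by fun_prop⟩

theorem firstHalf_zero : firstHalf 0 = 0 := by simp [firstHalf]

theorem firstHalf_one : firstHalf 1 = 1 := by
  simp only [firstHalf, ContinuousMap.coe_mk]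
  exact Set.projIcc_of_right_le _ (by norm_num)

theorem firstHalf_eq_one_or (s : I) : firstHalf (unitInterval.symm s) = 1 ∨ firstHalf s = 1 := by
  simp only [firstHalf, ContinuousMap.coe_mk]
  rcases le_total (1 / 2 : ℝ) s with h | h
  · exact Or.inr (Set.projIcc_of_right_le _ (by linarith))
  · exact Or.inl (Set.projIcc_of_right_le _ (by rw [unitInterval.coe_symm_eq]; linarith))

/-- The homotopy in `fibHomotopic_joinHat` lies over the time `max u v` of a path, where `(u, v)`
runs along two edges of a square from `(t, 0)` through `(t, t)` to `(0, t)`; constancy of the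
maximum makes it fibrewise. -/
theorem max_edge (t s : I) : max (edgeFst (t, s)) (edgeSnd (t, s)) = t := by
  simp only [edgeFst, edgeSnd, ContinuousMap.coe_mk]
  rcases firstHalf_eq_one_or s with h | h
  · rw [h, mul_one]
    exact max_eq_left unitInterval.mul_le_left
  · rw [h, mul_one]
    exact max_eq_right unitInterval.mul_le_left

/-- A map over `X` from the join of `f` and `ι` to `PathSpace e`, composed with the inclusion in the
next join, is fibrewise homotopic to the join of its restriction with `A`. -/
theorem fibHomotopic_joinHat {e : C(E, X)} {ι : C(A, X)} {f : C(B, X)}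
    (φ : C(Join f ι, PathSpace e)) (hφ : ∀ w, PathSpace.proj e (φ w) = joinMap f ι w) :
    FibHomotopic (joinMap e ι) (joinMap f ι) ((inlHat e ι).comp φ)
      (joinHat ι (φ.comp (HPushout.inl _ _)) (fun b => hφ (HPushout.inl _ _ b))) := by
  -- The image of the cylinder point at height `t` is paired with what remains of its path after
  -- time `t`; waiting at time `t` first, by `max`, avoids a reparametrization.
  let d : C(HPullback f ι × I, HPullback (PathSpace.proj e) ι) :=
    HPullback.lift (φ.comp (HPushout.cyl _ _))
      ⟨fun z => HPullback.path f ι z.1.1 (max z.1.2 z.2), by fun_prop⟩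
      ((HPullback.snd f ι).comp ContinuousMap.fst)
      (fun z => (congrArg (HPullback.path f ι z.1) (max_eq_left z.2.2.1)).trans
        (hφ (HPushout.cyl _ _ z)).symm)
      (fun z => (congrArg (HPullback.path f ι z.1) (max_eq_right z.2.2.2)).trans
        (HPullback.path_one f ι z.1))
  let dA : C(A, HPullback (PathSpace.proj e) ι) :=
    HPullback.lift (φ.comp (HPushout.inr _ _)) (ι.comp ContinuousMap.fst) (ContinuousMap.id A)
      (fun a => (hφ (HPushout.inr _ _ a)).symm) (fun _ => rfl)
  have hd1 (w : HPullback f ι) : d (w, 1) = dA (HPullback.snd f ι w) :=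
    HPullback.ext (congrArg φ (HPushout.cyl_one _ _ w))
      (fun τ => (congrArg (HPullback.path f ι w) (max_eq_left τ.2.2)).trans
        (HPullback.path_one f ι w)) rfl
  have hd0 (w : HPullback f ι) : d (w, 0) = pullbackMap ι (φ.comp (HPushout.inl _ _))
      (fun b => hφ (HPushout.inl _ _ b)) w :=
    HPullback.ext (congrArg φ (HPushout.cyl_zero _ _ w))
      (fun τ => congrArg (HPullback.path f ι w) (max_eq_right τ.2.1)) rfl
  -- At `(u, v) = (t, 0)` this is `φ` followed by the inclusion, and at `(0, t)` it is the join of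
  -- the restriction of `φ`.
  let c : C((HPullback f ι × I) × I, PathSpace (joinMap e ι)) :=
    (cylHat e ι).comp ⟨fun z => (d (z.1.1, edgeFst (z.1.2, z.2)), edgeSnd (z.1.2, z.2)),
      by fun_prop⟩
  let K : C(Join f ι, C(I, PathSpace (joinMap e ι))) :=
    HPushout.whisker _ _
      (((inlHat e ι).comp (φ.comp (HPushout.inl _ _))).comp ContinuousMap.fst).curry
      ((cylHat e ι).comp (dA.prodMap firstHalf)).curry c.curry
      (fun w => ContinuousMap.ext fun s => by
        change cylHat e ι (d (w, 0 * _), 0 * _) = inlHat e ι (φ (HPushout.inl _ _ _))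
        rw [zero_mul, zero_mul, cylHat_zero]
        exact congrArg (fun v => inlHat e ι (φ v)) (HPushout.cyl_zero _ _ w))
      (fun w => ContinuousMap.ext fun s => by
        change cylHat e ι (d (w, 1 * _), 1 * _) = cylHat e ι (dA _, firstHalf s)
        rw [one_mul, one_mul]
        -- If `u = 1`, then `d` is already `dA`; if `v = 1`, only the endpoint in `A` matters.
        rcases firstHalf_eq_one_or s with h | h
        · rw [h, hd1]
        · rw [h, cylHat_one, cylHat_one]
          rfl)
  refine FibHomotopic.of_curried K ?_ ?_ ?_
  · refine HPushout.induction (fun b => rfl) (fun a => ?_) (fun w t => ?_)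
    · change cylHat e ι (dA a, firstHalf 0) = _
      rw [firstHalf_zero, cylHat_zero]
      rfl
    · change cylHat e ι (d (w, t * firstHalf (unitInterval.symm 0)), t * firstHalf 0) = _
      rw [firstHalf_zero, unitInterval.symm_zero, firstHalf_one, mul_zero, mul_one, cylHat_zero]
      rfl
  · refine HPushout.induction (fun b => rfl) (fun a => ?_) (fun w t => ?_)
    · change cylHat e ι (dA a, firstHalf 1) = _
      rw [firstHalf_one, cylHat_one]
      rfl
    · change cylHat e ι (d (w, t * firstHalf (unitInterval.symm 1)), t * firstHalf 1) = _
      rw [firstHalf_one, unitInterval.symm_one, firstHalf_zero, mul_zero, mul_one, hd0]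
      rfl
  · refine HPushout.induction (fun b s => hφ _) (fun a s => rfl) (fun w t s => ?_)
    exact congrArg (HPullback.path f ι w) (max_edge t s)

end PathSpace

/-! ### Coherent sections along the Ganea tower -/

section Stages

variable {A X : Type u} [TopologicalSpace A] [TopologicalSpace X] (ι : C(A, X))

theorem g_gamma {k n : ℕ} (h : k ≤ n) (x : G ι k) : g ι n (gamma ι h x) = g ι k x := by
  induction n, h using Nat.le_induction with
  | base => rw [gamma_self]; rfl
  | succ n h ih => rw [gamma_succ]; exact ih

theorem gamma_gammaSucc {k n : ℕ} (h : k + 1 ≤ n) :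
    (gamma ι h).comp (gammaSucc ι k) = gamma ι (Nat.le_of_succ_le h) := by
  induction n, h using Nat.le_induction with
  | base => rw [gamma_self, gamma_succ ι (le_refl k), gamma_self]; rfl
  | succ n h ih =>
    rw [gamma_succ ι h, ContinuousMap.comp_assoc, ih, gamma_succ ι (Nat.le_of_succ_le h)]

/-- A homotopy section `ρ` of `g_n`, as a section of the path fibration that replaces `g_n`, such
that `ρ ∘ g_k` is fibrewise homotopic to `γ_{k,n}`. -/
def HasCoherentSection {k n : ℕ} (h : k ≤ n) : Prop :=
  ∃ ρ : C(X, PathSpace (g ι n)), (∀ x, PathSpace.proj (g ι n) (ρ x) = x) ∧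
    FibHomotopic (g ι n) (g ι k) (ρ.comp (g ι k)) ((PathSpace.const (g ι n)).comp (gamma ι h))

theorem exists_section_pathSpace {E : Type u} [TopologicalSpace E] {f : C(E, X)} {s : C(X, E)}
    (hs : IsHomotopySection f s) :
    ∃ ρ : C(X, PathSpace f), ∀ x, PathSpace.proj f (ρ x) = x := by
  obtain ⟨H⟩ := hs
  exact ⟨HPullback.lift s (H.toContinuousMap.comp ContinuousMap.prodSwap) (ContinuousMap.id X)
    (fun x => H.apply_zero x) (fun x => H.apply_one x), fun _ => rfl⟩

theorem isHomotopySection_fst {E : Type u} [TopologicalSpace E] {f : C(E, X)}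
    {ρ : C(X, PathSpace f)} (hρ : ∀ x, PathSpace.proj f (ρ x) = x) :
    IsHomotopySection f ((HPullback.fst f _).comp ρ) :=
  ⟨{ toFun := fun z => HPullback.path f _ (ρ z.2) z.1
     continuous_toFun := by fun_prop
     map_zero_left := fun x => HPullback.path_zero f _ (ρ x)
     map_one_left := fun x => (HPullback.path_one f _ (ρ x)).trans (hρ x) }⟩

/-- Both maps from `A` factor over `X` through stage `n`, so at stage `n + 1` both are fibrewise
homotopic to the new inclusion of `A`. -/
theorem hasCoherentSection_zero {n : ℕ} {s : C(X, G ι n)} (hs : IsHomotopySection (g ι n) s) :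
    HasCoherentSection ι (Nat.zero_le (n + 1)) := by
  obtain ⟨ρ, hρ⟩ := exists_section_pathSpace hs
  refine ⟨(inlHat (g ι n) ι).comp ρ, hρ, ?_⟩
  rw [gamma_succ ι (Nat.zero_le n)]
  exact (fibHomotopic_inrHat (ρ.comp ι) (fun a => hρ _)).trans
    (fibHomotopic_inrHat ((PathSpace.const (g ι n)).comp (gamma ι (Nat.zero_le n)))
      (fun a => g_gamma ι _ a)).symm

-- After one more stage, `ρ ∘ g_{k+1}` and `γ_{k+1,n}` are determined up to fibrewise homotopy by
-- their restrictions to `G_k`, which agree by hypothesis. The bound `k + 1 ≤ n` ensures that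
-- `γ_{k+1,n}` exists.
variable {ι} in
theorem HasCoherentSection.succ {k n : ℕ} (hkn : k + 1 ≤ n)
    (h : HasCoherentSection ι (Nat.le_of_succ_le hkn)) :
    HasCoherentSection ι (Nat.succ_le_succ (Nat.le_of_succ_le hkn)) := by
  obtain ⟨ρ, hρ, hρk⟩ := h
  refine ⟨(inlHat (g ι n) ι).comp ρ, hρ, ?_⟩
  have h1 := fibHomotopic_joinHat (f := g ι k) (ι := ι) (ρ.comp (g ι (k + 1)))
    (fun w => hρ (g ι (k + 1) w))
  have h2 := fibHomotopic_joinHat (f := g ι k) (ι := ι)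
    ((PathSpace.const (g ι n)).comp (gamma ι hkn)) (fun w => g_gamma ι hkn w)
  have h3 : FibHomotopic (g ι n) (g ι k) (ρ.comp (g ι k))
      (((PathSpace.const (g ι n)).comp (gamma ι hkn)).comp (gammaSucc ι k)) := by
    rw [ContinuousMap.comp_assoc, gamma_gammaSucc]
    exact hρk
  have h4 := h3.joinHat (ι := ι) (fun b => hρ _) (fun b => g_gamma ι hkn (gammaSucc ι k b))
  have h5 := (h1.trans h4).trans h2.symm
  have h6 : gamma ι (Nat.succ_le_succ (Nat.le_of_succ_le hkn))
      = (gammaSucc ι n).comp (gamma ι hkn) := gamma_succ ι hkn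
  rw [h6]
  exact h5

theorem hasCoherentSection {n : ℕ} {s : C(X, G ι n)} (hs : IsHomotopySection (g ι n) s) (k : ℕ) :
    HasCoherentSection ι (show k ≤ n + k + 1 by omega) := by
  induction k with
  | zero => exact hasCoherentSection_zero ι hs
  | succ k ih => exact ih.succ (by omega)

theorem secat_le_relcat (k : ℕ) : secat ι ≤ relcat k ι := by
  refine sInf_le_sInf ?_
  rintro _ ⟨n, rfl, _, s, hs, _⟩
  exact ⟨n, rfl, s, hs⟩

theorem relcat_le_of_section {n : ℕ} {s : C(X, G ι n)} (hs : IsHomotopySection (g ι n) s)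
    (k : ℕ) : relcat k ι ≤ n + k + 1 := by
  obtain ⟨ρ, hρ, hρk⟩ := hasCoherentSection ι hs k
  exact sInf_le ⟨n + k + 1, by push_cast; rfl, by omega, (HPullback.fst _ _).comp ρ,
    isHomotopySection_fst hρ, hρk.homotopic_fst⟩

theorem relcat_le_secat_add (k : ℕ) : relcat k ι ≤ secat ι + k + 1 := by
  rcases Set.eq_empty_or_nonempty
    {N : ℕ∞ | ∃ n : ℕ, N = n ∧ ∃ s : C(X, G ι n), IsHomotopySection (g ι n) s} with h | h
  · simp [secat, h]
  -- A nonempty set in `ℕ∞` attains its infimum, so there is a section at stage `secat ι` itself.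
  · obtain ⟨n, hn, s, hs⟩ := csInf_mem h
    rw [secat, hn]
    exact relcat_le_of_section ι hs k

end Stages

end Ganea

theorem mainTheorem3 {A X : Type u} [TopologicalSpace A] [TopologicalSpace X] (ι : C(A, X))
    (k : ℕ) :
    Ganea.secat ι ≤ Ganea.relcat k ι ∧ Ganea.relcat k ι ≤ Ganea.secat ι + k + 1 :=
  ⟨Ganea.secat_le_relcat ι k, Ganea.relcat_le_secat_add ι k⟩
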